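/- Let $X,Y,A,B$ be finite sets and let $\lambda : X\times Y\times A\times B\to\{0,1\}$; write $\mathcal G=(X,Y,A,B,\lambda)$. Suppose that $\mathcal G$ is an imitation game, that is: * for all $x\in X$ and $a\ne a'$ in $A$ there is $y\in Y$ with $\sum_{b\in B}\lambda(x,y,a,b)\,\lambda(x,y,a',b)=0$, and * for all $y\in Y$ and $b\ne b'$ in $B$ there is $x\in X$ with $\sum_{a\in A}\lambda(x,y,a,b)\,\lambda(x,y,a,b')=0$. A non-signalling correlation is a family of real numbers $p(a,b|x,y)\ge 0$ such that $\sum_{a,b}p(a,b|x,y)=1$ for all $x,y$, such that $\sum_b p(a,b|x,y)$ does not depend on $y$, and such that $\sum_a p(a,b|x,y)$ does not depend on $x$. It is a perfect quantum commuting strategy for $\mathcal G$ if $p(a,b|x,y)=0$ whenever $\lambda(x,y,a,b)=0$, and there are a complex Hilbert space $H$, a unit vector $\xi\in H$ and, for all $x\in X$ and $y\in Y$, families of projections $(P_{x,a})_{a\in A}$ and $(Q_{y,b})_{b\in B}$ on $H$, each with sum $I$, such that $P_{x,a}Q_{y,b}=Q_{y,b}P_{x,a}$ and $p(a,b|x,y)=\langle\xi,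 P_{x,a}Q_{y,b}\,\xi\rangle$ for all $x,y,a,b$. Let $C^*(\mathcal G)$ be the universal unital C*-algebra (possibly the zero algebra) generated by projections $p_{x,a}$ ($x\in X$, $a\in A$) and $q_{y,b}$ ($y\in Y$, $b\in B$) subject to the relations $\sum_{a}p_{x,a}=1$ for all $x$, $\sum_b q_{y,b}=1$ for all $y$, and $p_{x,a}q_{y,b}=0$ whenever $\lambda(x,y,a,b)=0$. A tracial state on it is a positive linear functional $\tau$ with $\tau(1)=1$ and $\tau(uv)=\tau(vu)$ for all $u,v$. Then: 1. for every non-signalling correlation $p$, $p$ is a perfect quantum commuting strategy for $\mathcal G$ if and only if $C^*(\mathcal G)\neq 0$ and there is a tracial state $\tau$ on $C^*(\mathcal G)$ such that $p(a,b|x,y)=\tau(p_{x,a}q_{y,b})$ for all $x,y,a,b$; 2. $\mathcal G$ has a perfect quantum commuting strategy if and only if $C^*(\mathcal G)\neq 0$ and $C^*(\mathcal G)$ has a tracial state. -/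

import Mathlib

open scoped InnerProductSpace ComplexOrder

noncomputable section

universe uX uY uA uB

/-- A non-signalling (two-player, single-round) game: a rule function with values in `{0, 1}`
on questions `X`, `Y` and answers `A`, `B`. -/
structure Game (X : Type uX) (Y : Type uY) (A : Type uA) (B : Type uB) where
  /-- The rule function `λ(x, y, a, b)`. -/
  rule : X → Y → A → B → ℕ
  rule_eq : ∀ x y a b, rule x y a b = 0 ∨ rule x y a b = 1

/-- A family `p a b x y`, read `p(a, b | x, y)`, is a non-signalling correlation. -/
structure IsNonsignallingCorrelation {X : Type uX} {Y : Type uY} {A : Type uA} {B : Type uB}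
    [Fintype A] [Fintype B] (p : A → B → X → Y → ℝ) : Prop where
  nonneg : ∀ a b x y, 0 ≤ p a b x y
  sum_eq_one : ∀ x y, ∑ a, ∑ b, p a b x y = 1
  nosignal_right : ∀ x y y' a, ∑ b, p a b x y = ∑ b, p a b x y'
  nosignal_left : ∀ x x' y b, ∑ a, p a b x y = ∑ a, p a b x' y

/-- A projection-valued measure: projections with sum the identity. -/
structure IsPVM {ι : Type*} [Fintype ι] {H : Type*} [NormedAddCommGroup H]
    [InnerProductSpace ℂ H] [CompleteSpace H] (P : ι → H →L[ℂ] H) : Prop where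
  isStarProjection : ∀ i, IsStarProjection (P i)
  sum_eq_one : ∑ i, P i = 1

/-- Quantum commuting correlations: `p(a, b | x, y) = ⟨ξ, P_{x,a} Q_{y,b} ξ⟩` for mutually
commuting families of PVMs on a Hilbert space and a unit vector `ξ`. Such a correlation always
has a realisation on a separable Hilbert space, so the universe of `H` imposes no restriction. -/
def IsQuantumCommuting {X : Type uX} {Y : Type uY} {A : Type uA} {B : Type uB}
    [Fintype A] [Fintype B] (p : A → B → X → Y → ℝ) : Prop :=
  ∃ (H : Type (max uX uY uA uB)) (_ : NormedAddCommGroup H) (_ : InnerProductSpace ℂ H)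
    (_ : CompleteSpace H) (P : X → A → H →L[ℂ] H) (Q : Y → B → H →L[ℂ] H) (ξ : H),
    (∀ x, IsPVM (P x)) ∧ (∀ y, IsPVM (Q y)) ∧
    (∀ x y a b, P x a * Q y b = Q y b * P x a) ∧ ‖ξ‖ = 1 ∧
    ∀ a b x y, (p a b x y : ℂ) = ⟪ξ, (P x a * Q y b) ξ⟫_ℂ

/-- A tracial state on a unital C*-algebra. -/
structure IsTracialState {𝒜 : Type*} [CStarAlgebra 𝒜] (τ : 𝒜 →ₗ[ℂ] ℂ) : Prop where
  nonneg : ∀ a, 0 ≤ τ (star a * a)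
  map_one : τ 1 = 1
  trace : ∀ a b, τ (a * b) = τ (b * a)

namespace Game

section

variable {X : Type uX} {Y : Type uY} {A : Type uA} {B : Type uB}

/-- Imitation games: for every question `x` and distinct answers `a ≠ a'` there is a question `y`
for which no answer `b` is acceptable together with both, and vice versa. -/
structure IsImitation [Fintype A] [Fintype B] (G : Game X Y A B) : Prop where
  left : ∀ (x : X) (a a' : A), a ≠ a' →
    ∃ y : Y, ∑ b, G.rule x y a b * G.rule x y a' b = 0
  right : ∀ (y : Y) (b b' : B), b ≠ b' →
    ∃ x : X, ∑ a, G.rule x y a b * G.rule x y a b' = 0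

/-- Perfect quantum commuting strategies of the game `G`: quantum commuting (non-signalling)
correlations that vanish wherever the rule function does. -/
structure IsPerfectQCStrategy [Fintype A] [Fintype B] (G : Game X Y A B)
    (p : A → B → X → Y → ℝ) : Prop where
  nonsignalling : IsNonsignallingCorrelation p
  quantumCommuting : IsQuantumCommuting p
  perfect : ∀ x y a b, G.rule x y a b = 0 → p a b x y = 0

/-! ### The free `*`-algebra on self-adjoint generators `p_{x,a}`, `q_{y,b}` -/

/-- The free unital complex `*`-algebra on self-adjoint generators indexed by `X × A` and
`Y × B`: finite linear combinations of words. -/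
def FreeStarAlg (_G : Game X Y A B) : Type (max uX uY uA uB) :=
  MonoidAlgebra ℂ (FreeMonoid ((X × A) ⊕ (Y × B)))

variable (G : Game X Y A B)

instance : Ring G.FreeStarAlg :=
  inferInstanceAs (Ring (MonoidAlgebra ℂ (FreeMonoid ((X × A) ⊕ (Y × B)))))

instance : Algebra ℂ G.FreeStarAlg :=
  inferInstanceAs (Algebra ℂ (MonoidAlgebra ℂ (FreeMonoid ((X × A) ⊕ (Y × B)))))

/-- The scalar multiple `c • w` of a word `w`. -/
def word (w : FreeMonoid ((X × A) ⊕ (Y × B))) (c : ℂ) : G.FreeStarAlg :=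
  MonoidAlgebra.single w c

theorem word_mul_word (w w' : FreeMonoid ((X × A) ⊕ (Y × B))) (c c' : ℂ) :
    G.word w c * G.word w' c' = G.word (w * w') (c * c') :=
  MonoidAlgebra.single_mul_single ..

theorem word_one : G.word 1 1 = 1 := rfl

theorem smul_word (w : FreeMonoid ((X × A) ⊕ (Y × B))) (c d : ℂ) :
    c • G.word w d = G.word w (c * d) :=
  MonoidAlgebra.smul_single ..

@[elab_as_elim]
theorem word_induction {motive : G.FreeStarAlg → Prop} (f : G.FreeStarAlg) (zero : motive 0)
    (add : ∀ f g, motive f → motive g → motive (f + g))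
    (word : ∀ w c, motive (G.word w c)) : motive f :=
  MonoidAlgebra.induction_linear (motive := motive) f zero add word

/-- The involution: reverse the words and conjugate the coefficients. -/
def starHom : G.FreeStarAlg →+ G.FreeStarAlg :=
  MonoidAlgebra.liftNC
    (R := MonoidAlgebra ℂ (FreeMonoid ((X × A) ⊕ (Y × B))))
    ((MonoidAlgebra.singleOneRingHom.toAddMonoidHom).comp (starAddEquiv (R := ℂ)).toAddMonoidHom)
    (fun w => MonoidAlgebra.single (star w) 1)

theorem starHom_word (w : FreeMonoid ((X × A) ⊕ (Y × B))) (c : ℂ) :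
    G.starHom (G.word w c) = G.word (star w) (star c) := by
  refine (MonoidAlgebra.liftNC_single ..).trans ?_
  refine (MonoidAlgebra.single_mul_single ..).trans ?_
  simp [word]

instance : StarRing G.FreeStarAlg where
  star := G.starHom
  star_involutive f := by
    induction f using G.word_induction with
    | zero => simp
    | add f g hf hg => rw [map_add, map_add, hf, hg]
    | word w c => simp [starHom_word]
  star_mul f g := by
    induction f using G.word_induction with
    | zero => simp
    | add f f' hf hf' => rw [add_mul, map_add, hf, hf', map_add, mul_add]
    | word w c =>
      induction g using G.word_induction with
      | zero => simp
      | add g g' hg hg' => rw [mul_add, map_add, hg, hg', map_add, add_mul]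
      | word w' c' => simp only [starHom_word, word_mul_word, star_mul]
  star_add f g := map_add _ f g

theorem star_word (w : FreeMonoid ((X × A) ⊕ (Y × B))) (c : ℂ) :
    star (G.word w c) = G.word (star w) (star c) := G.starHom_word w c

instance : StarModule ℂ G.FreeStarAlg where
  star_smul c f := by
    induction f using G.word_induction with
    | zero => simp
    | add f g hf hg => rw [smul_add, star_add, hf, hg, star_add, smul_add]
    | word w d => simp only [star_word, smul_word, star_mul, mul_comm]

/-- The free generator `p_{x,a}`. -/
def freeP (x : X) (a : A) : G.FreeStarAlg := G.word (FreeMonoid.of (Sum.inl (x, a))) 1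

/-- The free generator `q_{y,b}`. -/
def freeQ (y : Y) (b : B) : G.FreeStarAlg := G.word (FreeMonoid.of (Sum.inr (y, b))) 1

theorem star_freeP (x : X) (a : A) : star (G.freeP x a) = G.freeP x a := by
  simp [freeP, star_word]

theorem star_freeQ (y : Y) (b : B) : star (G.freeQ y b) = G.freeQ y b := by
  simp [freeQ, star_word]

/-! ### The game C*-algebra -/

variable [Fintype A] [Fintype B]

/-- The C*-seminorms on the free `*`-algebra that annihilate the defining relations of the
game C*-algebra. -/
structure IsAdmissible (N : Seminorm ℂ G.FreeStarAlg) : Prop where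
  mul_le : ∀ f g, N (f * g) ≤ N f * N g
  star_mul_self : ∀ f, N (star f * f) = N f ^ 2
  idem_p : ∀ x a, N (G.freeP x a * G.freeP x a - G.freeP x a) = 0
  idem_q : ∀ y b, N (G.freeQ y b * G.freeQ y b - G.freeQ y b) = 0
  sum_p : ∀ x, N (∑ a, G.freeP x a - 1) = 0
  sum_q : ∀ y, N (∑ b, G.freeQ y b - 1) = 0
  rule : ∀ x y a b, G.rule x y a b = 0 → N (G.freeP x a * G.freeQ y b) = 0

theorem isAdmissible_zero : G.IsAdmissible 0 := by
  constructor <;> intros <;> simp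

variable {G} in
theorem IsAdmissible.proj_le_one {N : Seminorm ℂ G.FreeStarAlg} (hN : G.IsAdmissible N)
    (g : G.FreeStarAlg) (hs : star g = g) (hi : N (g * g - g) = 0) : N g ≤ 1 := by
  have h1 := hN.star_mul_self g
  rw [hs] at h1
  have h2 : N (g * g) ≤ N (g * g - g) + N g := by
    simpa using map_add_le_add N (g * g - g) g
  nlinarith [apply_nonneg N g]

variable {G} in
theorem IsAdmissible.word_le {N : Seminorm ℂ G.FreeStarAlg} (hN : G.IsAdmissible N)
    (w : FreeMonoid ((X × A) ⊕ (Y × B))) (c : ℂ) : N (G.word w c) ≤ ‖c‖ := by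
  have key : N (G.word w 1) ≤ 1 := by
    induction w using FreeMonoid.inductionOn' with
    | one => exact hN.proj_le_one 1 (star_one _) (by simp)
    | of_mul z w ih =>
      have hz : N (G.word (FreeMonoid.of z) 1) ≤ 1 := by
        rcases z with ⟨x, a⟩ | ⟨y, b⟩
        · exact hN.proj_le_one _ (G.star_freeP x a) (hN.idem_p x a)
        · exact hN.proj_le_one _ (G.star_freeQ y b) (hN.idem_q y b)
      have h := hN.mul_le (G.word (FreeMonoid.of z) 1) (G.word w 1)
      rw [word_mul_word, one_mul] at h
      exact h.trans (mul_le_one₀ hz (apply_nonneg _ _) ih)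
  have h : G.word w c = c • G.word w 1 := by rw [smul_word, mul_one]
  rw [h, map_smul_eq_mul]
  exact mul_le_of_le_one_right (norm_nonneg c) key

theorem bddAbove_admissible (f : G.FreeStarAlg) :
    BddAbove (Set.range fun N : {N // G.IsAdmissible N} => N.1 f) := by
  induction f using G.word_induction with
  | zero => exact ⟨0, by rintro _ ⟨N, rfl⟩; simp⟩
  | add f g hf hg =>
    obtain ⟨C, hC⟩ := hf
    obtain ⟨D, hD⟩ := hg
    refine ⟨C + D, ?_⟩
    rintro _ ⟨N, rfl⟩
    exact (map_add_le_add N.1 f g).trans (add_le_add (hC ⟨N, rfl⟩) (hD ⟨N, rfl⟩))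
  | word w c => exact ⟨‖c‖, by rintro _ ⟨N, rfl⟩; exact N.2.word_le w c⟩

/-- The universal C*-norm: the supremum of all admissible C*-seminorms. -/
instance : Norm G.FreeStarAlg where
  norm f := ⨆ N : {N // G.IsAdmissible N}, N.1 f

instance : Nonempty {N // G.IsAdmissible N} := ⟨0, G.isAdmissible_zero⟩

variable {G} in
theorem IsAdmissible.le_norm {N : Seminorm ℂ G.FreeStarAlg} (hN : G.IsAdmissible N)
    (f : G.FreeStarAlg) : N f ≤ ‖f‖ :=
  le_ciSup (G.bddAbove_admissible f) ⟨N, hN⟩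

theorem norm_le_of_admissible {f : G.FreeStarAlg} {C : ℝ}
    (h : ∀ N, G.IsAdmissible N → N f ≤ C) : ‖f‖ ≤ C :=
  ciSup_le fun N => h N.1 N.2

theorem norm_eq_zero_of_admissible {f : G.FreeStarAlg}
    (h : ∀ N, G.IsAdmissible N → N f = 0) : ‖f‖ = 0 :=
  le_antisymm (G.norm_le_of_admissible fun N hN => (h N hN).le)
    ((apply_nonneg _ f).trans (G.isAdmissible_zero.le_norm f))

/-- The universal C*-norm as a ring seminorm. -/
def universalSeminorm : RingSeminorm G.FreeStarAlg where
  toFun f := ‖f‖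
  map_zero' := G.norm_eq_zero_of_admissible fun N _ => map_zero N
  add_le' f g := G.norm_le_of_admissible fun N hN =>
    (map_add_le_add N f g).trans (add_le_add (hN.le_norm f) (hN.le_norm g))
  neg' f := by simp only [norm, map_neg_eq_map]
  mul_le' f g := G.norm_le_of_admissible fun N hN =>
    (hN.mul_le f g).trans (mul_le_mul (hN.le_norm f) (hN.le_norm g) (apply_nonneg N g)
      ((apply_nonneg N f).trans (hN.le_norm f)))

instance : SeminormedRing G.FreeStarAlg := G.universalSeminorm.toSeminormedRing

instance : NormedAlgebra ℂ G.FreeStarAlg where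
  norm_smul_le c f := G.norm_le_of_admissible fun N hN => by
    rw [map_smul_eq_mul]
    exact mul_le_mul_of_nonneg_left (hN.le_norm f) (norm_nonneg c)

theorem norm_mul_self_le (f : G.FreeStarAlg) : ‖f‖ * ‖f‖ ≤ ‖star f * f‖ := by
  have h : ‖f‖ ≤ √‖star f * f‖ := G.norm_le_of_admissible fun N hN =>
    Real.le_sqrt_of_sq_le ((hN.star_mul_self f).symm.le.trans (hN.le_norm _))
  exact (mul_self_le_mul_self (norm_nonneg f) h).trans_eq (Real.mul_self_sqrt (norm_nonneg _))

instance : NormedStarGroup G.FreeStarAlg where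
  norm_star_le f := G.norm_le_of_admissible fun N hN => by
    refine le_trans ?_ (hN.le_norm f)
    have h1 := hN.star_mul_self (star f)
    have h2 := hN.mul_le (star (star f)) (star f)
    rw [star_star] at h1 h2
    nlinarith [apply_nonneg N f, apply_nonneg N (star f)]

/-- The C*-algebra of the game `G`: the universal unital C*-algebra generated by projections
`p_{x,a}`, `q_{y,b}` subject to the relations of the game, obtained as the separated completion
of the free `*`-algebra in the universal C*-norm. -/
def CStarAlg : Type (max uX uY uA uB) := UniformSpace.Completion G.FreeStarAlg

instance : NormedRing G.CStarAlg :=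
  inferInstanceAs (NormedRing (UniformSpace.Completion G.FreeStarAlg))

instance : CompleteSpace G.CStarAlg :=
  inferInstanceAs (CompleteSpace (UniformSpace.Completion G.FreeStarAlg))

/-- The canonical map from the free `*`-algebra to the game C*-algebra. -/
def ofFree : G.FreeStarAlg →+* G.CStarAlg :=
  (UniformSpace.Completion.coeRingHom :
    G.FreeStarAlg →+* UniformSpace.Completion G.FreeStarAlg)

instance : NormedAlgebra ℂ G.CStarAlg where
  toAlgebra := inferInstanceAs (Algebra ℂ (UniformSpace.Completion G.FreeStarAlg))
  norm_smul_le c f :=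
    norm_smul_le (α := ℂ) (β := UniformSpace.Completion G.FreeStarAlg) c f

theorem ofFree_smul (c : ℂ) (f : G.FreeStarAlg) : G.ofFree (c • f) = c • G.ofFree f :=
  UniformSpace.Completion.coe_smul c f

theorem norm_ofFree (f : G.FreeStarAlg) : ‖G.ofFree f‖ = ‖f‖ :=
  UniformSpace.Completion.norm_coe f

theorem continuous_ofFree : Continuous G.ofFree :=
  UniformSpace.Completion.continuous_coe G.FreeStarAlg

theorem denseRange_ofFree : DenseRange G.ofFree :=
  UniformSpace.Completion.denseRange_coe

instance : Star G.CStarAlg where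
  star := (UniformSpace.Completion.map (star : G.FreeStarAlg → G.FreeStarAlg) :
    UniformSpace.Completion G.FreeStarAlg → UniformSpace.Completion G.FreeStarAlg)

theorem ofFree_star (f : G.FreeStarAlg) : G.ofFree (star f) = star (G.ofFree f) :=
  (UniformSpace.Completion.map_coe
    (starₗᵢ ℂ : G.FreeStarAlg ≃ₗᵢ⋆[ℂ] G.FreeStarAlg).isometry.uniformContinuous f).symm

theorem continuous_star_cstarAlg : Continuous (star : G.CStarAlg → G.CStarAlg) :=
  UniformSpace.Completion.continuous_map

instance : StarRing G.CStarAlg where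
  star_involutive u :=
    G.denseRange_ofFree.induction_on u
      (isClosed_eq (G.continuous_star_cstarAlg.comp G.continuous_star_cstarAlg) continuous_id)
      fun f => by simp only [← ofFree_star, star_star]
  star_mul u v := by
    have hs := G.continuous_star_cstarAlg
    refine G.denseRange_ofFree.induction_on₂
      (p := fun u v : G.CStarAlg => star (u * v) = star v * star u) ?_ (fun f g => ?_) u v
    · exact isClosed_eq (hs.comp (continuous_fst.mul continuous_snd))
        ((hs.comp continuous_snd).mul (hs.comp continuous_fst))
    · simp only [← ofFree_star, ← map_mul, star_mul]
  star_add u v := by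
    have hs := G.continuous_star_cstarAlg
    refine G.denseRange_ofFree.induction_on₂
      (p := fun u v : G.CStarAlg => star (u + v) = star u + star v) ?_ (fun f g => ?_) u v
    · exact isClosed_eq (hs.comp (continuous_fst.add continuous_snd))
        ((hs.comp continuous_fst).add (hs.comp continuous_snd))
    · simp only [← ofFree_star, ← map_add, star_add]

instance : CStarAlgebra G.CStarAlg where
  star_smul c u := by
    have hs := G.continuous_star_cstarAlg
    refine G.denseRange_ofFree.induction_on u
      (isClosed_eq (hs.comp (continuous_const_smul c)) (hs.const_smul (star c))) fun f => ?_
    simp only [← ofFree_star, ← ofFree_smul, star_smul]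
  norm_mul_self_le u := by
    have hs := G.continuous_star_cstarAlg
    refine G.denseRange_ofFree.induction_on u
      (isClosed_le (continuous_norm.mul continuous_norm)
        (continuous_norm.comp (hs.mul continuous_id))) fun f => ?_
    simpa only [← ofFree_star, ← map_mul, norm_ofFree] using G.norm_mul_self_le f

/-- The canonical generator `p_{x,a}` of the game C*-algebra. -/
def genP (x : X) (a : A) : G.CStarAlg := G.ofFree (G.freeP x a)

/-- The canonical generator `q_{y,b}` of the game C*-algebra. -/
def genQ (y : Y) (b : B) : G.CStarAlg := G.ofFree (G.freeQ y b)

/-- The defining relations of the game C*-algebra for families in a unital C*-algebra. -/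
structure Relations {𝒟 : Type*} [CStarAlgebra 𝒟] (p : X → A → 𝒟) (q : Y → B → 𝒟) : Prop where
  proj_p : ∀ x a, IsStarProjection (p x a)
  proj_q : ∀ y b, IsStarProjection (q y b)
  sum_p : ∀ x, ∑ a, p x a = 1
  sum_q : ∀ y, ∑ b, q y b = 1
  rule : ∀ x y a b, G.rule x y a b = 0 → p x a * q y b = 0

theorem ofFree_eq_zero {f : G.FreeStarAlg} (h : ∀ N, G.IsAdmissible N → N f = 0) :
    G.ofFree f = 0 := by
  rw [← norm_eq_zero, norm_ofFree, G.norm_eq_zero_of_admissible h]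

/-- The canonical generators satisfy the defining relations. -/
theorem relations_gen : G.Relations G.genP G.genQ where
  proj_p x a := by
    refine ⟨?_, ?_⟩
    · have h := G.ofFree_eq_zero fun N hN => hN.idem_p x a
      rwa [map_sub, map_mul, sub_eq_zero] at h
    · rw [IsSelfAdjoint, genP, ← ofFree_star, star_freeP]
  proj_q y b := by
    refine ⟨?_, ?_⟩
    · have h := G.ofFree_eq_zero fun N hN => hN.idem_q y b
      rwa [map_sub, map_mul, sub_eq_zero] at h
    · rw [IsSelfAdjoint, genQ, ← ofFree_star, star_freeQ]
  sum_p x := by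
    have h := G.ofFree_eq_zero fun N hN => hN.sum_p x
    rwa [map_sub, map_sum, map_one, sub_eq_zero] at h
  sum_q y := by
    have h := G.ofFree_eq_zero fun N hN => hN.sum_q y
    rwa [map_sub, map_sum, map_one, sub_eq_zero] at h
  rule x y a b hr := by
    have h := G.ofFree_eq_zero fun N hN => hN.rule x y a b hr
    rwa [map_mul] at h

/-- The universal property of the game C*-algebra. -/
theorem existsUnique_starAlgHom {𝒟 : Type*} [CStarAlgebra 𝒟] {p : X → A → 𝒟} {q : Y → B → 𝒟}
    (h : G.Relations p q) :
    ∃! φ : G.CStarAlg →⋆ₐ[ℂ] 𝒟,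
      (∀ x a, φ (G.genP x a) = p x a) ∧ ∀ y b, φ (G.genQ y b) = q y b := by
  let g : (X × A) ⊕ (Y × B) → 𝒟 := Sum.elim (fun z => p z.1 z.2) (fun z => q z.1 z.2)
  have hg : ∀ z, star (g z) = g z := by
    rintro (⟨x, a⟩ | ⟨y, b⟩)
    · exact (h.proj_p x a).isSelfAdjoint
    · exact (h.proj_q y b).isSelfAdjoint
  let φ₀ : G.FreeStarAlg →ₐ[ℂ] 𝒟 :=
    (MonoidAlgebra.lift ℂ 𝒟 (FreeMonoid ((X × A) ⊕ (Y × B))) (FreeMonoid.lift g) :)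
  have hw : ∀ w c, φ₀ (G.word w c) = c • FreeMonoid.lift g w := fun w c =>
    MonoidAlgebra.lift_single ..
  have hP : ∀ x a, φ₀ (G.freeP x a) = p x a := fun x a => by simp [freeP, hw, g]
  have hQ : ∀ y b, φ₀ (G.freeQ y b) = q y b := fun y b => by simp [freeQ, hw, g]
  have hlift : ∀ w, FreeMonoid.lift g (star w) = star (FreeMonoid.lift g w) := fun w => by
    induction w using FreeMonoid.inductionOn' with
    | one => simp
    | of_mul z w ih => simp [ih, hg]
  have hstar : ∀ f, φ₀ (star f) = star (φ₀ f) := fun f => by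
    induction f using G.word_induction with
    | zero => simp
    | add f f' hf hf' => rw [star_add, map_add, hf, hf', map_add, star_add]
    | word w c => rw [star_word, hw, hw, hlift, star_smul]
  let N : Seminorm ℂ G.FreeStarAlg := (normSeminorm ℂ 𝒟).comp φ₀.toLinearMap
  have hNf : ∀ f, N f = ‖φ₀ f‖ := fun f => rfl
  have hN : G.IsAdmissible N := by
    constructor
    · intro f f'; simp only [hNf, map_mul]; exact norm_mul_le _ _
    · intro f; simp only [hNf, map_mul, hstar, CStarRing.norm_star_mul_self, sq]
    · intro x a; simp [hNf, hP, (h.proj_p x a).isIdempotentElem.eq]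
    · intro y b; simp [hNf, hQ, (h.proj_q y b).isIdempotentElem.eq]
    · intro x; simp [hNf, hP, h.sum_p]
    · intro y; simp [hNf, hQ, h.sum_q]
    · intro x y a b hr; simp [hNf, hP, hQ, h.rule x y a b hr]
  have hcont : Continuous φ₀.toRingHom :=
    AddMonoidHomClass.continuous_of_bound φ₀.toRingHom 1 fun f =>
      (hN.le_norm f).trans_eq (one_mul _).symm
  let φ₁ : G.CStarAlg →+* 𝒟 := UniformSpace.Completion.extensionHom φ₀.toRingHom hcont
  have hφ₁ : ∀ f, φ₁ (G.ofFree f) = φ₀ f := fun f =>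
    UniformSpace.Completion.extensionHom_coe φ₀.toRingHom hcont f
  have hφ₁c : Continuous φ₁ := UniformSpace.Completion.continuous_extension
  let φ : G.CStarAlg →⋆ₐ[ℂ] 𝒟 :=
    { φ₁ with
      commutes' := fun c => by
        have h1 : algebraMap ℂ G.CStarAlg c = G.ofFree (algebraMap ℂ _ c) := rfl
        change φ₁ _ = _
        rw [h1, hφ₁, AlgHom.commutes]
      map_star' := fun u => by
        change φ₁ _ = star (φ₁ _)
        refine G.denseRange_ofFree.induction_on u
          (isClosed_eq (hφ₁c.comp G.continuous_star_cstarAlg) (continuous_star.comp hφ₁c))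
          fun f => ?_
        rw [← ofFree_star, hφ₁, hφ₁, hstar] }
  refine ⟨φ, ⟨fun x a => (hφ₁ _).trans (hP x a), fun y b => (hφ₁ _).trans (hQ y b)⟩, ?_⟩
  rintro ψ ⟨hψP, hψQ⟩
  have key : ∀ f, ψ (G.ofFree f) = φ (G.ofFree f) := fun f => by
    induction f using G.word_induction with
    | zero => simp
    | add f f' hf hf' => rw [map_add, map_add, hf, hf', map_add]
    | word w c =>
      have hc : G.word w c = c • G.word w 1 := by rw [smul_word, mul_one]
      rw [hc, ofFree_smul, map_smul, map_smul]
      congr 1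
      induction w using FreeMonoid.inductionOn' with
      | one => rw [word_one, map_one, map_one, map_one]
      | of_mul z w ih =>
        have hm : G.word (FreeMonoid.of z * w) 1 = G.word (FreeMonoid.of z) 1 * G.word w 1 := by
          rw [word_mul_word, one_mul]
        rw [hm, map_mul, map_mul, map_mul, ih (by rw [smul_word, mul_one])]
        congr 1
        rcases z with ⟨x, a⟩ | ⟨y, b⟩
        · exact (hψP x a).trans ((hφ₁ _).trans (hP x a)).symm
        · exact (hψQ y b).trans ((hφ₁ _).trans (hQ y b)).symm
  ext u
  refine G.denseRange_ofFree.induction_on u (isClosed_eq ?_ ?_) key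
  · exact AddMonoidHomClass.continuous_of_bound ψ 1 fun v =>
      (NonUnitalStarAlgHom.norm_apply_le ψ v).trans_eq (one_mul _).symm
  · exact hφ₁c

end

end Game

end

/-!
The two halves of the correspondence are each realised by an explicit construction.

*From a trace to a strategy.* In the GNS space of a tracial state `τ` on `C*(G)`, left
multiplication by `p_{x,a}` and right multiplication by `q_{y,b}` are commuting projections, the
second being symmetric because `τ` is a trace (`IsTracialState.exists_commuting_pvms`). The vector
of `1` then realises `τ (p_{x,a} q_{y,b})`.

*From a strategy to a trace.* Let `P`, `Q`, `ξ` realise a perfect strategy, so that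
`P_{x,a} Q_{y,b} ξ = 0` whenever the rule forbids `(x, y, a, b)`. Let `E_{y,b}` be the projection
onto the common kernel of all `P_{x,a}` with `(x, y, a, b)` forbidden. The imitation property gives
`E_{y,b} ξ = Q_{y,b} ξ` (`exists_projection_apply_eq`), and symmetrically there are projections
`F_{x,a}`, commuting with everything that commutes with the `Q`s, such that
`F_{x,a} ξ = P_{x,a} ξ`. Every `P_{x,a}` and `E_{y,b}` lies in the commutant `M` of the `Q`s and
acts on `ξ` like a projection commuting with `M`. Hence it lies in the centralizer
`{c ∈ M | ⟪ξ, m c ξ⟫ = ⟪ξ, c m ξ⟫ for all m ∈ M}`, a `*`-algebra `Z` on which the functional of `ξ`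
is a trace (`vectorCentralizer`, `mem_vectorCentralizer_of_apply_eq`). An element of `Z` that kills
`ξ` vanishes on the closure of `Z ξ` (`cyclicRestrict_eq_zero`). The operators `∑ b, E_{y,b} - 1`
and, for forbidden `(x, y, a, b)`, `P_{x,a} E_{y,b}` kill `ξ`, so the `P`s and `E`s restricted to
that subspace satisfy the relations of the game. This gives a representation of `C*(G)`, in which
`ξ` is a trace vector and `⟪ξ, P_{x,a} E_{y,b} ξ⟫ = ⟪ξ, P_{x,a} Q_{y,b} ξ⟫`.
-/

open scoped InnerProductSpace ComplexOrder

noncomputable section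

universe uX uY uA uB

/-! ### Tracial states and the GNS space -/

/-- The completion of a pre-inner product space, to which every symmetric idempotent linear map
extends as a projection; boundedness of such maps is automatic. -/
theorem exists_hilbert_completion {V : Type uX} [AddCommGroup V] [Module ℂ V]
    (c : PreInnerProductSpace.Core ℂ V) :
    ∃ (H : Type uX) (_ : NormedAddCommGroup H) (_ : InnerProductSpace ℂ H)
      (_ : CompleteSpace H) (ι : V →ₗ[ℂ] H), DenseRange ι ∧
      (∀ u v, ⟪ι u, ι v⟫_ℂ = c.inner u v) ∧
      ∀ T : V →ₗ[ℂ] V, (∀ u v, c.inner (T u) v = c.inner u (T v)) → (∀ u, T (T u) = T u) →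
        ∃ P : H →L[ℂ] H, IsStarProjection P ∧ ∀ v, P (ι v) = ι (T v) := by
  let _ : SeminormedAddCommGroup V := InnerProductSpace.Core.toSeminormedAddCommGroup (c := c)
  let _ : InnerProductSpace ℂ V := InnerProductSpace.ofCore c
  have hdense : DenseRange ((↑) : V → UniformSpace.Completion V) :=
    UniformSpace.Completion.denseRange_coe
  refine ⟨UniformSpace.Completion V, inferInstance, inferInstance, inferInstance,
    (UniformSpace.Completion.toComplL (𝕜 := ℂ) (E := V)).toLinearMap, hdense,
    fun u v => UniformSpace.Completion.inner_coe u v, fun T hsymm hidem => ?_⟩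
  have hsymm' : ∀ u v : V, ⟪T u, v⟫_ℂ = ⟪u, T v⟫_ℂ := hsymm
  -- A symmetric idempotent is contractive: `‖T u‖² = ⟪u, T u⟫ ≤ ‖u‖ ‖T u‖`.
  have hbound : ∀ u : V, ‖T u‖ ≤ 1 * ‖u‖ := fun u => by
    have h1 : ‖T u‖ * ‖T u‖ ≤ ‖u‖ * ‖T u‖ := by
      calc ‖T u‖ * ‖T u‖ = ‖⟪u, T u⟫_ℂ‖ := by
            rw [← hidem u, ← hsymm' u (T u), hidem u, inner_self_eq_norm_sq_to_K]; simp [sq]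
        _ ≤ ‖u‖ * ‖T u‖ := norm_inner_le_norm u (T u)
    nlinarith [norm_nonneg (T u), norm_nonneg u]
  let S : V →L[ℂ] V := T.mkContinuous 1 hbound
  have hS : ∀ v : V, S.completion (v : UniformSpace.Completion V) = (T v : V) := fun v =>
    ContinuousLinearMap.completion_apply_coe S v
  refine ⟨S.completion, ⟨?_, ?_⟩, hS⟩
  · ext u
    induction u using UniformSpace.Completion.induction_on with
    | hp => apply isClosed_eq <;> fun_prop
    | ih u => simp only [mul_apply_eq_comp, hS, hidem]
  · rw [ContinuousLinearMap.isSelfAdjoint_iff_isSymmetric]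
    intro u v
    induction u, v using UniformSpace.Completion.induction_on₂ with
    | hp => apply isClosed_eq <;> simp only [ContinuousLinearMap.coe_coe] <;> fun_prop
    | ih u v =>
      simp only [ContinuousLinearMap.coe_coe, hS, UniformSpace.Completion.inner_coe, hsymm']

namespace IsTracialState

variable {𝒜 : Type uX} [CStarAlgebra 𝒜] {τ : 𝒜 →ₗ[ℂ] ℂ}

theorem map_star (hτ : IsTracialState τ) (a : 𝒜) : τ (star a) = star (τ a) := by
  have h : ∀ b : 𝒜, (τ (star b * b)).im = 0 := fun b =>
    (Complex.nonneg_iff.1 (hτ.nonneg b)).2.symm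
  -- Polarisation: `τ (b⋆ b)` is real for `b = 1, a, 1 + a, 1 + i a`.
  have h1 := h (1 + a)
  have h2 := h (1 + Complex.I • a)
  have h0 := h 1
  have ha := h a
  simp [add_mul, mul_add, smul_smul] at h1 h2 h0 ha
  apply Complex.ext <;> simp <;> linarith

theorem nonneg_of_isStarProjection (hτ : IsTracialState τ) {p q : 𝒜} (hp : IsStarProjection p)
    (hq : IsStarProjection q) : 0 ≤ τ (p * q) := by
  have h := hτ.nonneg (q * p)
  rwa [star_mul, hp.isSelfAdjoint.star_eq, hq.isSelfAdjoint.star_eq, hτ.trace,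
    mul_assoc q p, ← mul_assoc p p, hp.isIdempotentElem.eq, hτ.trace, mul_assoc,
    hq.isIdempotentElem.eq] at h

/-- The positive semidefinite sesquilinear form `(u, v) ↦ τ (u⋆ v)`. -/
abbrev core (hτ : IsTracialState τ) : PreInnerProductSpace.Core ℂ 𝒜 where
  inner u v := τ (star u * v)
  conj_inner_symm u v := by simp [← Complex.star_def, ← hτ.map_star]
  re_inner_nonneg u := (Complex.nonneg_iff.1 (hτ.nonneg u)).1
  add_left u v w := by rw [star_add, add_mul, map_add]
  smul_left u v r := by simp

/-- In the GNS space of a tracial state, left multiplication by `p` and right multiplication by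
`q` are commuting projections; the latter is symmetric by traciality. -/
theorem exists_commuting_pvms (hτ : IsTracialState τ) {X : Type*} {Y : Type*} {A : Type*}
    {B : Type*} [Fintype A] [Fintype B] {p : X → A → 𝒜} {q : Y → B → 𝒜}
    (hp : ∀ x a, IsStarProjection (p x a)) (hq : ∀ y b, IsStarProjection (q y b))
    (hps : ∀ x, ∑ a, p x a = 1) (hqs : ∀ y, ∑ b, q y b = 1) :
    ∃ (H : Type uX) (_ : NormedAddCommGroup H) (_ : InnerProductSpace ℂ H)
      (_ : CompleteSpace H) (P : X → A → H →L[ℂ] H) (Q : Y → B → H →L[ℂ] H) (ξ : H),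
      (∀ x, IsPVM (P x)) ∧ (∀ y, IsPVM (Q y)) ∧
      (∀ x y a b, P x a * Q y b = Q y b * P x a) ∧ ‖ξ‖ = 1 ∧
      ∀ x y a b, τ (p x a * q y b) = ⟪ξ, (P x a * Q y b) ξ⟫_ℂ := by
  obtain ⟨H, i1, i2, i3, ι, hι, hinner, hT⟩ := exists_hilbert_completion hτ.core
  have hinner' : ∀ u v, ⟪ι u, ι v⟫_ℂ = τ (star u * v) := hinner
  have hL : ∀ x a, ∃ P : H →L[ℂ] H, IsStarProjection P ∧ ∀ v, P (ι v) = ι (p x a * v) :=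
    fun x a => hT (LinearMap.mulLeft ℂ (p x a))
      (fun u v => by
        change τ (star (p x a * u) * v) = τ (star u * (p x a * v))
        rw [star_mul, (hp x a).isSelfAdjoint.star_eq, mul_assoc])
      (fun u => by simp [← mul_assoc, (hp x a).isIdempotentElem.eq])
  have hR : ∀ y b, ∃ Q : H →L[ℂ] H, IsStarProjection Q ∧ ∀ v, Q (ι v) = ι (v * q y b) :=
    fun y b => hT (LinearMap.mulRight ℂ (q y b))
      (fun u v => by
        change τ (star (u * q y b) * v) = τ (star u * (v * q y b))
        rw [star_mul, (hq y b).isSelfAdjoint.star_eq, mul_assoc, hτ.trace, mul_assoc])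
      (fun u => by simp [mul_assoc, (hq y b).isIdempotentElem.eq])
  choose P hP hPι using hL
  choose Q hQ hQι using hR
  have hext : ∀ S T : H →L[ℂ] H, (∀ v, S (ι v) = T (ι v)) → S = T := fun S T h => by
    refine ContinuousLinearMap.ext fun u => ?_
    exact congrFun (hι.equalizer S.continuous T.continuous (funext h)) u
  refine ⟨H, i1, i2, i3, P, Q, ι 1, fun x => ⟨hP x, hext _ _ fun v => ?_⟩,
    fun y => ⟨hQ y, hext _ _ fun v => ?_⟩, fun x y a b => hext _ _ fun v => ?_, ?_,
    fun x y a b => ?_⟩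
  · simp [hPι, ← map_sum, ← Finset.sum_mul, hps]
  · simp [hQι, ← map_sum, ← Finset.mul_sum, hqs]
  · simp [hPι, hQι, mul_assoc]
  · rw [norm_eq_sqrt_re_inner (𝕜 := ℂ), hinner']
    simp [hτ.map_one]
  · simp [hPι, hQι, hinner']

end IsTracialState

/-! ### Projections implementing the other player's measurement -/

section

variable {X Y A B H : Type*} [Fintype A] [Fintype B] [NormedAddCommGroup H]
  [InnerProductSpace ℂ H] [CompleteSpace H]

/-- The projection onto a closed subspace commutes with every operator which, together with its
adjoint, leaves the subspace invariant. -/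
theorem commute_starProjection_of_invariant (U : Submodule ℂ H) [U.HasOrthogonalProjection]
    {m : H →L[ℂ] H} (hm : ∀ v ∈ U, m v ∈ U) (hm' : ∀ v ∈ U, star m v ∈ U) :
    Commute m U.starProjection := by
  refine ContinuousLinearMap.ext fun v => ?_
  refine (U.eq_starProjection_of_mem_orthogonal (u := m v)
    (hm _ (U.starProjection_apply_mem v)) ?_).symm
  rw [← map_sub, Submodule.mem_orthogonal]
  intro w hw
  rw [← ContinuousLinearMap.adjoint_inner_left]
  exact U.sub_starProjection_mem_orthogonal v _ (hm' w hw)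

/-- The projection `E` onto `{v | P_{x,a} v = 0 for all x, a with r x y a b}` implements `Q_{y,b}`
at `ξ`: it fixes `Q_{y,b} ξ`, and `Q_{y,b'} ξ` is orthogonal to its range when `b' ≠ b`, because
for a suitable `x` each `P_{x,a}` kills `Q_{y,b'} ξ` or the whole range. -/
theorem exists_projection_apply_eq {P : X → A → H →L[ℂ] H} {Q : Y → B → H →L[ℂ] H} {ξ : H}
    {r : X → Y → A → B → Prop} (hP : ∀ x, IsPVM (P x)) (hQ : ∀ y, IsPVM (Q y))
    (hr : ∀ x y a b, r x y a b → P x a (Q y b ξ) = 0)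
    (himit : ∀ y b b', b ≠ b' → ∃ x, ∀ a, r x y a b ∨ r x y a b') (y : Y) (b : B) :
    ∃ E : H →L[ℂ] H, IsStarProjection E ∧ E ξ = Q y b ξ ∧
      ∀ m, (∀ x a, Commute m (P x a)) → Commute m E := by
  let U : Submodule ℂ H := ⨅ (x) (a) (_ : r x y a b), (P x a).ker
  have hU : ∀ v, v ∈ U ↔ ∀ x a, r x y a b → P x a v = 0 := fun v => by
    simp [U, Submodule.mem_iInf]
  have hUc : IsClosed (U : Set H) := by
    have : (U : Set H) = ⋂ (x) (a) (_ : r x y a b), {v | P x a v = 0} := by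
      ext v; simp [hU]
    rw [this]
    exact isClosed_iInter fun x => isClosed_iInter fun a => isClosed_iInter fun _ =>
      isClosed_eq (P x a).continuous continuous_const
  have : CompleteSpace U := hUc.completeSpace_coe
  refine ⟨U.starProjection, isStarProjection_starProjection, ?_, fun m hm => ?_⟩
  · have hsum : ξ = ∑ b', Q y b' ξ := by
      rw [← sum_apply, (hQ y).sum_eq_one, one_apply_eq_self]
    conv_lhs => rw [hsum, map_sum]
    rw [Finset.sum_eq_single b]
    · exact Submodule.starProjection_eq_self_iff.2 ((hU _).2 fun x a h => hr x y a b h)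
    · intro b' _ hb'
      rw [Submodule.starProjection_apply_eq_zero_iff, Submodule.mem_orthogonal]
      intro v hv
      obtain ⟨x, hx⟩ := himit y b b' hb'.symm
      have hproj : ∀ a, ⟪v, P x a (Q y b' ξ)⟫_ℂ = 0 := fun a => by
        rcases hx a with h | h
        · rw [← ContinuousLinearMap.adjoint_inner_left, ← ContinuousLinearMap.star_eq_adjoint,
            ((hP x).isStarProjection a).isSelfAdjoint.star_eq, (hU v).1 hv x a h, inner_zero_left]
        · rw [hr x y a b' h, inner_zero_right]
      calc ⟪v, Q y b' ξ⟫_ℂ = ⟪v, (∑ a, P x a) (Q y b' ξ)⟫_ℂ := by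
            rw [(hP x).sum_eq_one, one_apply_eq_self]
        _ = 0 := by
            rw [sum_apply, inner_sum]
            exact Finset.sum_eq_zero fun a _ => hproj a
    · simp
  · have hinv : ∀ n : H →L[ℂ] H, (∀ x a, Commute n (P x a)) → ∀ v ∈ U, n v ∈ U := by
      intro n hn v hv
      refine (hU _).2 fun x a h => ?_
      rw [← mul_apply_eq_comp, ← (hn x a).eq, mul_apply_eq_comp,
        (hU v).1 hv x a h, map_zero]
    refine commute_starProjection_of_invariant U (hinv m hm) (hinv (star m) fun x a => ?_)
    have h := (hm x a).star_star
    rwa [((hP x).isStarProjection a).isSelfAdjoint.star_eq] at h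

end

/-! ### The centralizer of a vector state -/

section

variable {H : Type*} [NormedAddCommGroup H] [InnerProductSpace ℂ H] [CompleteSpace H]

theorem inner_star_apply (T : H →L[ℂ] H) (u v : H) : ⟪u, star T v⟫_ℂ = ⟪T u, v⟫_ℂ := by
  rw [ContinuousLinearMap.star_eq_adjoint, ContinuousLinearMap.adjoint_inner_right]

/-- The elements `c` of a `*`-algebra `M` of operators with `⟪ξ, m c ξ⟫ = ⟪ξ, c m ξ⟫` for all
`m ∈ M`: the centralizer of the vector functional of `ξ`, on which that functional is a trace. -/
def vectorCentralizer (M : StarSubalgebra ℂ (H →L[ℂ] H)) (ξ : H) :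
    StarSubalgebra ℂ (H →L[ℂ] H) where
  carrier := {c | c ∈ M ∧ ∀ m ∈ M, ⟪ξ, (m * c) ξ⟫_ℂ = ⟪ξ, (c * m) ξ⟫_ℂ}
  mul_mem' := by
    rintro c d ⟨hc, hc'⟩ ⟨hd, hd'⟩
    refine ⟨mul_mem hc hd, fun m hm => ?_⟩
    rw [← mul_assoc, hd' _ (mul_mem hm hc), ← mul_assoc, hc' _ (mul_mem hd hm), mul_assoc]
  add_mem' := by
    rintro c d ⟨hc, hc'⟩ ⟨hd, hd'⟩
    refine ⟨add_mem hc hd, fun m hm => ?_⟩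
    simp only [mul_add, add_mul, add_apply, inner_add_right, hc' m hm,
      hd' m hm]
  algebraMap_mem' r :=
    ⟨algebraMap_mem M r, fun m _ => by rw [Algebra.commutes]⟩
  star_mem' := by
    rintro c ⟨hc, hc'⟩
    refine ⟨star_mem hc, fun m hm => ?_⟩
    have h := congrArg (starRingEnd ℂ) (hc' _ (star_mem hm))
    rw [inner_conj_symm, inner_conj_symm, ← inner_star_apply, ← inner_star_apply, star_mul,
      star_mul, star_star] at h
    exact h.symm

theorem mem_vectorCentralizer {M : StarSubalgebra ℂ (H →L[ℂ] H)} {ξ : H} {c : H →L[ℂ] H} :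
    c ∈ vectorCentralizer M ξ ↔ c ∈ M ∧ ∀ m ∈ M, ⟪ξ, (m * c) ξ⟫_ℂ = ⟪ξ, (c * m) ξ⟫_ℂ :=
  Iff.rfl

/-- A self-adjoint `c ∈ M` that agrees at `ξ` with a self-adjoint operator commuting with `M`
centralizes the vector functional of `ξ`. -/
theorem mem_vectorCentralizer_of_apply_eq {M : StarSubalgebra ℂ (H →L[ℂ] H)} {ξ : H}
    {c d : H →L[ℂ] H} (hc : c ∈ M) (hcs : IsSelfAdjoint c) (hds : IsSelfAdjoint d)
    (hd : ∀ m ∈ M, Commute m d) (h : c ξ = d ξ) : c ∈ vectorCentralizer M ξ := by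
  refine ⟨hc, fun m hm => ?_⟩
  calc ⟪ξ, (m * c) ξ⟫_ℂ = ⟪ξ, (m * d) ξ⟫_ℂ := by simp [h]
    _ = ⟪ξ, star d (m ξ)⟫_ℂ := by rw [(hd m hm).eq, hds.star_eq]; rfl
    _ = ⟪ξ, star c (m ξ)⟫_ℂ := by rw [inner_star_apply, inner_star_apply, h]
    _ = ⟪ξ, (c * m) ξ⟫_ℂ := by rw [hcs.star_eq]; rfl

/-- The closure of `Z ξ`. -/
def cyclicSubspace (Z : StarSubalgebra ℂ (H →L[ℂ] H)) (ξ : H) : Submodule ℂ H :=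
  (Z.toSubalgebra.toSubmodule.map
    (ContinuousLinearMap.apply ℂ H ξ).toLinearMap).topologicalClosure

theorem apply_mem_cyclicSubspace {Z : StarSubalgebra ℂ (H →L[ℂ] H)} (ξ : H) {c : H →L[ℂ] H}
    (hc : c ∈ Z) : c ξ ∈ cyclicSubspace Z ξ :=
  Submodule.le_topologicalClosure _ ⟨c, hc, rfl⟩

theorem cyclicSubspace_induction {Z : StarSubalgebra ℂ (H →L[ℂ] H)} {ξ : H} {motive : H → Prop}
    (hclosed : IsClosed {v | motive v}) (apply : ∀ c ∈ Z, motive (c ξ)) {v : H}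
    (hv : v ∈ cyclicSubspace Z ξ) : motive v := by
  refine closure_minimal ?_ hclosed hv
  rintro _ ⟨c, hc, rfl⟩
  exact apply c hc

theorem self_mem_cyclicSubspace (Z : StarSubalgebra ℂ (H →L[ℂ] H)) (ξ : H) :
    ξ ∈ cyclicSubspace Z ξ :=
  apply_mem_cyclicSubspace ξ (one_mem Z)

theorem cyclicSubspace_invariant {Z : StarSubalgebra ℂ (H →L[ℂ] H)} {ξ : H} {c : H →L[ℂ] H}
    (hc : c ∈ Z) {v : H} (hv : v ∈ cyclicSubspace Z ξ) : c v ∈ cyclicSubspace Z ξ := by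
  exact cyclicSubspace_induction (motive := fun v => c v ∈ cyclicSubspace Z ξ)
    ((Submodule.isClosed_topologicalClosure _).preimage c.continuous)
    (fun d hd => apply_mem_cyclicSubspace ξ (mul_mem hc hd)) hv

instance (Z : StarSubalgebra ℂ (H →L[ℂ] H)) (ξ : H) : CompleteSpace (cyclicSubspace Z ξ) :=
  (Submodule.isClosed_topologicalClosure _).completeSpace_coe

/-- The restriction of a `*`-algebra of operators to a cyclic subspace. -/
def cyclicRestrict (Z : StarSubalgebra ℂ (H →L[ℂ] H)) (ξ : H) :
    Z →⋆ₐ[ℂ] (cyclicSubspace Z ξ →L[ℂ] cyclicSubspace Z ξ) where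
  toFun c := ((c : H →L[ℂ] H) ∘L (cyclicSubspace Z ξ).subtypeL).codRestrict _
    fun v => cyclicSubspace_invariant c.2 v.2
  map_one' := rfl
  map_mul' _ _ := rfl
  map_zero' := rfl
  map_add' _ _ := rfl
  commutes' _ := rfl
  map_star' c := by
    rw [ContinuousLinearMap.star_eq_adjoint, ContinuousLinearMap.eq_adjoint_iff]
    intro u v
    exact ContinuousLinearMap.adjoint_inner_left (c : H →L[ℂ] H) (v : H) (u : H)

theorem coe_cyclicRestrict_apply {Z : StarSubalgebra ℂ (H →L[ℂ] H)} {ξ : H} (c : Z)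
    (v : cyclicSubspace Z ξ) : (cyclicRestrict Z ξ c v : H) = (c : H →L[ℂ] H) v := rfl

/-- `ξ` is a separating vector for the centralizer of its vector functional, restricted to the
cyclic subspace: if `c ξ = 0` then `‖c d ξ‖² = ⟪ξ, d⋆ c⋆ c d ξ⟫ = ⟪ξ, d d⋆ c⋆ c ξ⟫ = 0`. -/
theorem cyclicRestrict_eq_zero {M : StarSubalgebra ℂ (H →L[ℂ] H)} {ξ : H}
    (c : vectorCentralizer M ξ) (hc : (c : H →L[ℂ] H) ξ = 0) :
    cyclicRestrict (vectorCentralizer M ξ) ξ c = 0 := by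
  refine ContinuousLinearMap.ext fun ⟨v, hv⟩ => Subtype.ext ?_
  rw [coe_cyclicRestrict_apply]
  change (c : H →L[ℂ] H) v = 0
  refine cyclicSubspace_induction (motive := fun v => (c : H →L[ℂ] H) v = 0)
    (isClosed_eq c.1.continuous continuous_const) (fun d hd => ?_) hv
  · have h := hd.2 (star d * (star c.1 * c.1))
      (mul_mem (star_mem hd.1) (mul_mem (star_mem c.2.1) c.2.1))
    have h0 : (d * (star d * (star c.1 * c.1))) ξ = 0 := by simp [hc]
    have h1 : (star d * (star c.1 * c.1) * d) = star (c.1 * d) * (c.1 * d) := by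
      simp only [star_mul, mul_assoc]
    rw [h0, inner_zero_right, h1, mul_apply_eq_comp, inner_star_apply,
      inner_self_eq_zero] at h
    exact h

end

/-! ### Perfect strategies and traces -/

namespace Game

section

variable {X : Type uX} {Y : Type uY} {A : Type uA} {B : Type uB} [Fintype A] [Fintype B]
  {G : Game X Y A B}

theorem IsImitation.exists_right (hG : G.IsImitation) (y : Y) (b b' : B) (h : b ≠ b') :
    ∃ x, ∀ a, G.rule x y a b = 0 ∨ G.rule x y a b' = 0 := by
  obtain ⟨x, hx⟩ := hG.right y b b' h
  exact ⟨x, fun a => mul_eq_zero.1 (Finset.sum_eq_zero_iff.1 hx a (Finset.mem_univ a))⟩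

theorem IsImitation.exists_left (hG : G.IsImitation) (x : X) (a a' : A) (h : a ≠ a') :
    ∃ y, ∀ b, G.rule x y a b = 0 ∨ G.rule x y a' b = 0 := by
  obtain ⟨y, hy⟩ := hG.left x a a' h
  exact ⟨y, fun b => mul_eq_zero.1 (Finset.sum_eq_zero_iff.1 hy b (Finset.mem_univ b))⟩

theorem continuous_starAlgHom {𝒟 : Type*} [CStarAlgebra 𝒟] (φ : G.CStarAlg →⋆ₐ[ℂ] 𝒟) :
    Continuous φ :=
  AddMonoidHomClass.continuous_of_bound φ 1 fun v =>
    (NonUnitalStarAlgHom.norm_apply_le φ v).trans_eq (one_mul _).symm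

/-- The vector functional of `ξ` is a trace on `C*(G)` when `φ` represents `C*(G)`
on a cyclic subspace with generators in a `*`-algebra on which that functional is a trace. -/
theorem isTracialState_of_starAlgHom {H : Type*} [NormedAddCommGroup H] [InnerProductSpace ℂ H]
    [CompleteSpace H] {Z : StarSubalgebra ℂ (H →L[ℂ] H)} {ξ : H} (hξ : ‖ξ‖ = 1)
    (hZ : ∀ c ∈ Z, ∀ d ∈ Z, ⟪ξ, (c * d) ξ⟫_ℂ = ⟪ξ, (d * c) ξ⟫_ℂ)
    (φ : G.CStarAlg →⋆ₐ[ℂ] (cyclicSubspace Z ξ →L[ℂ] cyclicSubspace Z ξ))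
    (hp : ∀ x a, φ (G.genP x a) ∈ (cyclicRestrict Z ξ).range)
    (hq : ∀ y b, φ (G.genQ y b) ∈ (cyclicRestrict Z ξ).range) :
    ∃ τ : G.CStarAlg →ₗ[ℂ] ℂ, IsTracialState τ ∧
      ∀ u, τ u = ⟪ξ, (φ u ⟨ξ, self_mem_cyclicSubspace _ ξ⟩ : H)⟫_ℂ := by
  let η : cyclicSubspace Z ξ := ⟨ξ, self_mem_cyclicSubspace Z ξ⟩
  let τ : G.CStarAlg →ₗ[ℂ] ℂ :=
    { toFun := fun u => ⟪η, φ u η⟫_ℂ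
      map_add' := fun u v => by rw [map_add, add_apply, inner_add_right]
      map_smul' := fun c u => by
        rw [map_smul, smul_apply, inner_smul_right]; rfl }
  have hτ : ∀ u, τ u = ⟪η, φ u η⟫_ℂ := fun u => rfl
  have hφc : Continuous φ :=
    continuous_starAlgHom (𝒟 := cyclicSubspace Z ξ →L[ℂ] cyclicSubspace Z ξ) φ
  have hτc : Continuous τ := by
    change Continuous fun u => ⟪η, φ u η⟫_ℂ
    fun_prop
  have hfree : ∀ f, φ (G.ofFree f) ∈ (cyclicRestrict Z ξ).range := fun f => by
    induction f using G.word_induction with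
    | zero => rw [map_zero, map_zero]; exact zero_mem _
    | add f g hf hg => rw [map_add, map_add]; exact add_mem hf hg
    | word w c =>
      have hc : G.word w c = c • G.word w 1 := by rw [smul_word, mul_one]
      rw [hc, ofFree_smul, map_smul]
      refine SMulMemClass.smul_mem c ?_
      clear hc
      induction w using FreeMonoid.inductionOn' with
      | one => rw [word_one, map_one, map_one]; exact one_mem _
      | of_mul z w ih =>
        have hm : G.word (FreeMonoid.of z * w) 1 = G.word (FreeMonoid.of z) 1 * G.word w 1 := by
          rw [word_mul_word, one_mul]
        rw [hm, map_mul, map_mul]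
        refine mul_mem ?_ ih
        rcases z with ⟨x, a⟩ | ⟨y, b⟩
        · exact hp x a
        · exact hq y b
  refine ⟨τ, ⟨fun u => ?_, ?_, fun u v => ?_⟩, fun u => rfl⟩
  · rw [hτ, map_mul, map_star, mul_apply_eq_comp, inner_star_apply]
    rw [inner_self_eq_norm_sq_to_K]
    change 0 ≤ ((‖φ u η‖ : ℝ) : ℂ) ^ 2
    exact_mod_cast sq_nonneg ‖φ u η‖
  · rw [hτ, map_one, one_apply_eq_self, inner_self_eq_norm_sq_to_K]
    change ((‖ξ‖ : ℝ) : ℂ) ^ 2 = 1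
    simp [hξ]
  · refine G.denseRange_ofFree.induction_on₂
      (p := fun u v : G.CStarAlg => τ (u * v) = τ (v * u)) ?_ (fun f g => ?_) u v
    · exact isClosed_eq (hτc.comp (continuous_fst.mul continuous_snd))
        (hτc.comp (continuous_snd.mul continuous_fst))
    · obtain ⟨c, hc⟩ := hfree f
      obtain ⟨d, hd⟩ := hfree g
      have hc' : cyclicRestrict Z ξ c = φ (G.ofFree f) := hc
      have hd' : cyclicRestrict Z ξ d = φ (G.ofFree g) := hd
      rw [hτ, hτ, map_mul, map_mul, ← hc', ← hd']
      exact hZ c c.2 d d.2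

/-- From a perfect strategy to a trace: both families of projections act on the cyclic subspace of
the centralizer of the state, where the relations of the game hold because they hold at `ξ`. -/
theorem IsPerfectQCStrategy.exists_isTracialState (hG : G.IsImitation) {p : A → B → X → Y → ℝ}
    (hp : G.IsPerfectQCStrategy p) :
    ∃ τ : G.CStarAlg →ₗ[ℂ] ℂ, IsTracialState τ ∧
      ∀ x y a b, (p a b x y : ℂ) = τ (G.genP x a * G.genQ y b) := by
  obtain ⟨H, _, _, _, P, Q, ξ, hP, hQ, hcomm, hξ, hpξ⟩ := hp.quantumCommuting
  have hPs := fun x a => ((hP x).isStarProjection a).isSelfAdjoint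
  have hQs := fun y b => ((hQ y).isStarProjection b).isSelfAdjoint
  -- `p(a, b | x, y) = ‖P_{x,a} Q_{y,b} ξ‖²`
  have hbad : ∀ x y a b, G.rule x y a b = 0 → P x a (Q y b ξ) = 0 := fun x y a b h => by
    have hPQ : IsStarProjection (P x a * Q y b) :=
      ((hP x).isStarProjection a).mul ((hQ y).isStarProjection b) (hcomm x y a b)
    have h0 := hpξ a b x y
    rw [hp.perfect x y a b h, ← hPQ.isIdempotentElem.eq, mul_apply_eq_comp] at h0
    nth_rewrite 1 [← hPQ.isSelfAdjoint.star_eq] at h0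
    rw [inner_star_apply, Complex.ofReal_zero, eq_comm, inner_self_eq_zero] at h0
    exact h0
  obtain hE := exists_projection_apply_eq (r := fun x y a b => G.rule x y a b = 0) hP hQ hbad
    hG.exists_right
  obtain hF := exists_projection_apply_eq (r := fun y x b a => G.rule x y a b = 0) hQ hP
    (fun y x b a h => by
      rw [← mul_apply_eq_comp, ← hcomm]
      exact hbad x y a b h) hG.exists_left
  choose E hEproj hEξ hEcomm using hE
  choose F hFproj hFξ hFcomm using hF
  -- The commutant of the projections `Q_{y,b}`.
  let M : StarSubalgebra ℂ (H →L[ℂ] H) :=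
    StarSubalgebra.centralizer ℂ (Set.range fun z : Y × B => Q z.1 z.2)
  have hM : ∀ m, m ∈ M ↔ ∀ y b, Commute m (Q y b) := fun m => by
    rw [StarSubalgebra.mem_centralizer_iff]
    constructor
    · exact fun h y b => (h _ ⟨(y, b), rfl⟩).1.symm
    · rintro h _ ⟨z, rfl⟩
      refine ⟨(h z.1 z.2).symm, ?_⟩
      rw [(hQs z.1 z.2).star_eq]
      exact (h z.1 z.2).symm
  have hPM : ∀ x a, P x a ∈ M := fun x a => (hM _).2 fun y b => hcomm x y a b
  have hEM : ∀ y b, E y b ∈ M := fun y b =>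
    (hM _).2 fun y' b' => (hEcomm y b _ fun x a => (hcomm x y' a b').symm).symm
  have hPZ : ∀ x a, P x a ∈ vectorCentralizer M ξ := fun x a =>
    mem_vectorCentralizer_of_apply_eq (hPM x a) (hPs x a) (hFproj x a).isSelfAdjoint
      (fun m hm => hFcomm x a m ((hM m).1 hm)) (hFξ x a).symm
  have hEZ : ∀ y b, E y b ∈ vectorCentralizer M ξ := fun y b =>
    mem_vectorCentralizer_of_apply_eq (hEM y b) (hEproj y b).isSelfAdjoint (hQs y b)
      (fun m hm => (hM m).1 hm y b) (hEξ y b)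
  let ρ := cyclicRestrict (vectorCentralizer M ξ) ξ
  let P' : X → A → vectorCentralizer M ξ := fun x a => ⟨P x a, hPZ x a⟩
  let E' : Y → B → vectorCentralizer M ξ := fun y b => ⟨E y b, hEZ y b⟩
  have hP' : ∀ x a, IsStarProjection (P' x a) := fun x a =>
    ⟨Subtype.ext ((hP x).isStarProjection a).isIdempotentElem, Subtype.ext (hPs x a)⟩
  have hE' : ∀ y b, IsStarProjection (E' y b) := fun y b =>
    ⟨Subtype.ext (hEproj y b).isIdempotentElem, Subtype.ext (hEproj y b).isSelfAdjoint⟩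
  have hrel : G.Relations (fun x a => ρ (P' x a)) (fun y b => ρ (E' y b)) := by
    refine ⟨fun x a => (hP' x a).map ρ, fun y b => (hE' y b).map ρ, fun x => ?_, fun y => ?_,
      fun x y a b h => ?_⟩
    · rw [← map_sum, ← map_one ρ]
      congr 1
      refine Subtype.ext ?_
      simpa [P'] using (hP x).sum_eq_one
    · rw [← map_sum, ← map_one ρ, ← sub_eq_zero, ← map_sub]
      refine cyclicRestrict_eq_zero _ ?_
      have h1 : ∑ b, Q y b ξ = ξ := by
        rw [← sum_apply, (hQ y).sum_eq_one, one_apply_eq_self]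
      simp [E', hEξ, h1]
    · rw [← map_mul]
      refine cyclicRestrict_eq_zero _ ?_
      simp [E', P', hEξ, hbad x y a b h]
  obtain ⟨φ, ⟨hφP, hφE⟩, -⟩ := G.existsUnique_starAlgHom hrel
  obtain ⟨τ, hτ, hτξ⟩ := isTracialState_of_starAlgHom hξ
    (fun c hc d hd =>
      (mem_vectorCentralizer.1 hd).2 c (mem_vectorCentralizer.1 hc).1) φ
    (fun x a => ⟨P' x a, (hφP x a).symm⟩) (fun y b => ⟨E' y b, (hφE y b).symm⟩)
  refine ⟨τ, hτ, fun x y a b => ?_⟩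
  rw [hτξ, map_mul, hφP, hφE, hpξ, mul_apply_eq_comp, ← hEξ]
  rfl

/-- From a trace to a perfect strategy: the GNS realisation, where the rule holds because
`p_{x,a} q_{y,b} = 0` already in the game C*-algebra. -/
theorem isPerfectQCStrategy_of_isTracialState {p : A → B → X → Y → ℝ}
    (hp : IsNonsignallingCorrelation p) {τ : G.CStarAlg →ₗ[ℂ] ℂ} (hτ : IsTracialState τ)
    (hpτ : ∀ x y a b, (p a b x y : ℂ) = τ (G.genP x a * G.genQ y b)) :
    G.IsPerfectQCStrategy p where
  nonsignalling := hp
  quantumCommuting := by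
    have h := G.relations_gen
    obtain ⟨H, i1, i2, i3, P, Q, ξ, hP, hQ, hc, hξ, h⟩ :=
      hτ.exists_commuting_pvms h.proj_p h.proj_q h.sum_p h.sum_q
    exact ⟨H, i1, i2, i3, P, Q, ξ, hP, hQ, hc, hξ, fun a b x y => (hpτ x y a b).trans (h x y a b)⟩
  perfect x y a b h := by
    rw [← Complex.ofReal_eq_zero, hpτ, G.relations_gen.rule x y a b h, map_zero]

theorem exists_isNonsignallingCorrelation {τ : G.CStarAlg →ₗ[ℂ] ℂ} (hτ : IsTracialState τ) :
    ∃ p : A → B → X → Y → ℝ, IsNonsignallingCorrelation p ∧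
      ∀ x y a b, (p a b x y : ℂ) = τ (G.genP x a * G.genQ y b) := by
  have hrel := G.relations_gen
  have hnn : ∀ x y a b, 0 ≤ τ (G.genP x a * G.genQ y b) := fun x y a b =>
    hτ.nonneg_of_isStarProjection (hrel.proj_p x a) (hrel.proj_q y b)
  have hB : ∀ x y a, ∑ b, (τ (G.genP x a * G.genQ y b)).re = (τ (G.genP x a)).re :=
    fun x y a => by
      rw [← Complex.re_sum, ← map_sum, ← Finset.mul_sum, hrel.sum_q, mul_one]
  have hA : ∀ x y b, ∑ a, (τ (G.genP x a * G.genQ y b)).re = (τ (G.genQ y b)).re :=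
    fun x y b => by
      rw [← Complex.re_sum, ← map_sum, ← Finset.sum_mul, hrel.sum_p, one_mul]
  refine ⟨fun a b x y => (τ (G.genP x a * G.genQ y b)).re,
    ⟨fun a b x y => (Complex.nonneg_iff.1 (hnn x y a b)).1, fun x y => ?_,
      fun x y y' a => by rw [hB, hB], fun x x' y b => by rw [hA, hA]⟩, fun x y a b => ?_⟩
  · simp only [hB]
    rw [← Complex.re_sum, ← map_sum, hrel.sum_p, hτ.map_one, Complex.one_re]
  · exact Complex.ext rfl (Complex.nonneg_iff.1 (hnn x y a b)).2

theorem nontrivial_of_isTracialState {τ : G.CStarAlg →ₗ[ℂ] ℂ} (hτ : IsTracialState τ) :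
    Nontrivial G.CStarAlg := by
  refine ⟨0, 1, fun h => ?_⟩
  have h1 := hτ.map_one
  rw [← h, map_zero] at h1
  exact zero_ne_one h1

end

end Game

end

theorem mainTheorem1 {X Y A B : Type*} [Fintype X] [Fintype Y] [Fintype A] [Fintype B]
    (G : Game X Y A B) (hG : G.IsImitation) :
    (∀ p : A → B → X → Y → ℝ, IsNonsignallingCorrelation p →
      (G.IsPerfectQCStrategy p ↔
        Nontrivial G.CStarAlg ∧
          ∃ τ : G.CStarAlg →ₗ[ℂ] ℂ, IsTracialState τ ∧
            ∀ x y a b, (p a b x y : ℂ) = τ (G.genP x a * G.genQ y b))) ∧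
    ((∃ p : A → B → X → Y → ℝ, G.IsPerfectQCStrategy p) ↔
      Nontrivial G.CStarAlg ∧ ∃ τ : G.CStarAlg →ₗ[ℂ] ℂ, IsTracialState τ) := by
  refine ⟨fun p hp => ⟨fun h => ?_, ?_⟩, ?_, ?_⟩
  · obtain ⟨τ, hτ, h⟩ := h.exists_isTracialState hG
    exact ⟨Game.nontrivial_of_isTracialState hτ, τ, hτ, h⟩
  · rintro ⟨-, τ, hτ, h⟩
    exact Game.isPerfectQCStrategy_of_isTracialState hp hτ h
  · rintro ⟨p, hp⟩
    obtain ⟨τ, hτ, -⟩ := hp.exists_isTracialState hG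
    exact ⟨Game.nontrivial_of_isTracialState hτ, τ, hτ⟩
  · rintro ⟨-, τ, hτ⟩
    obtain ⟨p, hp, h⟩ := Game.exists_isNonsignallingCorrelation hτ
    exact ⟨p, Game.isPerfectQCStrategy_of_isTracialState hp hτ h⟩
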